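/- **Theorem 4.2.** For a bounded linear operator $A$ between Hilbert spaces, let $N(A)$, $R(A)$ and $A^*$ denote its null space, range and adjoint. Let $H_1$ and $H_2$ be Hilbert spaces over the same field ($\mathbb{R}$ or $\mathbb{C}$), and let $L(H_i,H_j)$ denote the space of bounded linear operators from $H_i$ to $H_j$. A pair $(S,T)$ with $S\in L(H_1,H_2)$ and $T\in L(H_2,H_1)$ is called a *Fredholm pair* if the four dimensions $$a=\dim N(S)/(N(S)\cap R(T)),\qquad b=\dim R(T)/(N(S)\cap R(T)),$$ $$c=\dim N(T)/(N(T)\cap R(S)),\qquad d=\dim R(S)/(N(T)\cap R(S))$$ are finite; its index is then $\operatorname{ind}(S,T)=a-b-c+d$. An operator $A\in L(H,K)$ between Hilbert spaces is a *Fredholm operator* if $R(A)$ is closed and both $N(A)$ and $K/R(A)$ are finite dimensional; its index is then $\operatorname{ind}A=\dim N(A)-\dim K/R(A)$. Let $S\in L(H_1,H_2)$ and $T\in L(H_2,H_1)$ be such that $R(TS)$ and $R(ST)$ are finite dimensional. Then the following statements are equivalent: 1. $(S,T)$ is a Fredholm pair; 2. $S+T^*\in L(H_1,H_2)$ is a Fredholm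 operator; 3. $T+S^*\in L(H_2,H_1)$ is a Fredholm operator. Furthermore, in this case $$\operatorname{ind}(S,T)=\operatorname{ind}(S+T^*)=-\operatorname{ind}(T+S^*).$$ -/

import Mathlib

noncomputable section

/-- For subspaces `M`, `N` of a vector space, the quotient space `M / (M ∩ N)`. -/
abbrev QuotInf {𝕜 E : Type*} [Field 𝕜] [AddCommGroup E] [Module 𝕜 E]
    (M N : Submodule 𝕜 E) : Type _ :=
  ↥M ⧸ (M ⊓ N).submoduleOf M

/-- `(S, T)` is a Fredholm pair: the spaces `N(S)/(N(S) ∩ R(T))`, `R(T)/(N(S) ∩ R(T))`,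
`N(T)/(N(T) ∩ R(S))` and `R(S)/(N(T) ∩ R(S))` are all finite dimensional. -/
structure IsFredholmPair {𝕜 H₁ H₂ : Type*} [RCLike 𝕜]
    [NormedAddCommGroup H₁] [InnerProductSpace 𝕜 H₁]
    [NormedAddCommGroup H₂] [InnerProductSpace 𝕜 H₂]
    (S : H₁ →L[𝕜] H₂) (T : H₂ →L[𝕜] H₁) : Prop where
  finite_a : FiniteDimensional 𝕜 (QuotInf S.ker T.range)
  finite_b : FiniteDimensional 𝕜 (QuotInf T.range S.ker)
  finite_c : FiniteDimensional 𝕜 (QuotInf T.ker S.range)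
  finite_d : FiniteDimensional 𝕜 (QuotInf S.range T.ker)

/-- The index `a - b - c + d` of a pair `(S, T)`; meaningful when `(S, T)` is a Fredholm pair. -/
def pairIndex {𝕜 H₁ H₂ : Type*} [RCLike 𝕜]
    [NormedAddCommGroup H₁] [InnerProductSpace 𝕜 H₁]
    [NormedAddCommGroup H₂] [InnerProductSpace 𝕜 H₂]
    (S : H₁ →L[𝕜] H₂) (T : H₂ →L[𝕜] H₁) : ℤ :=
  (Module.finrank 𝕜 (QuotInf S.ker T.range) : ℤ)
    - (Module.finrank 𝕜 (QuotInf T.range S.ker) : ℤ)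
    - (Module.finrank 𝕜 (QuotInf T.ker S.range) : ℤ)
    + (Module.finrank 𝕜 (QuotInf S.range T.ker) : ℤ)

/-- The index `dim N(A) - dim (K / R(A))` of an operator `A : H → K`; meaningful when `A` is a
Fredholm operator. -/
def fredholmIndex {𝕜 H K : Type*} [RCLike 𝕜]
    [NormedAddCommGroup H] [InnerProductSpace 𝕜 H]
    [NormedAddCommGroup K] [InnerProductSpace 𝕜 K] (A : H →L[𝕜] K) : ℤ :=
  (Module.finrank 𝕜 A.ker : ℤ) - (Module.finrank 𝕜 (K ⧸ A.range) : ℤ)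

end

/-! If $TS=0$ and $ST=0$, then $b=d=0$. Moreover $Sx\perp T^*x$ for every $x$, so $N(S+T^*)=N(S)\cap
R(T)^\perp$, which represents $N(S)/R(T)$. The cokernel of $S+T^*$ is represented in the same way by
$N(T+S^*)$, hence by $N(T)/R(S)$, and the index is $a-c$.

The general case differs from this one by finite rank (`exists_comp_eq_zero_of_finite_range`), and
both notions are stable under such changes. Each index is a combination of relative indices $[M:N]$
of commensurable subspaces; these are additive (`relIndex_add`). Passing from $f$ to $g$ by finite
rank gives $[N(f):N(g)]=[R(g):R(f)]$ (`relIndex_ker_eq_relIndex_range`), so the changes cancel.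
Statements 2 and 3 are exchanged by taking adjoints. -/

open Module

/-! ### Commensurable subspaces and finite-rank perturbations -/

section RelativeDimension

variable {K E F : Type*} [Field K] [AddCommGroup E] [Module K E] [AddCommGroup F] [Module K F]

/-- The quotient `M / (M ∩ N)` is the image of `M` in the quotient by `N`. -/
noncomputable def quotInfEquivMap (M N : Submodule K E) : QuotInf M N ≃ₗ[K] M.map N.mkQ :=
  (Submodule.quotEquivOfEq _ (N.mkQ.domRestrict M).ker (by
      ext x; simp [Submodule.submoduleOf])).trans <|
    (N.mkQ.domRestrict M).quotKerEquivRange.trans <|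
      LinearEquiv.ofEq _ _ (LinearMap.range_domRestrict ..)

lemma finite_quotInf_iff_map (M N : Submodule K E) :
    FiniteDimensional K (QuotInf M N) ↔ FiniteDimensional K (M.map N.mkQ) :=
  Module.Finite.equiv_iff (quotInfEquivMap M N)

lemma finrank_quotInf (M N : Submodule K E) :
    finrank K (QuotInf M N) = finrank K (M.map N.mkQ) :=
  (quotInfEquivMap M N).finrank_eq

/-- Turns finiteness into an inclusion, which is easy to compose and to push through linear maps. -/
lemma finite_quotInf_iff_exists_le_sup {M N : Submodule K E} :
    FiniteDimensional K (QuotInf M N) ↔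
      ∃ G : Submodule K E, FiniteDimensional K G ∧ M ≤ N ⊔ G := by
  rw [finite_quotInf_iff_map]
  constructor
  · intro h
    obtain ⟨s, hs⟩ := N.mkQ.exists_rightInverse_of_surjective N.range_mkQ
    refine ⟨(M.map N.mkQ).map s, inferInstance, fun x hx ↦ ?_⟩
    rw [← sub_add_cancel x (s (N.mkQ x))]
    refine Submodule.add_mem_sup ?_ (Submodule.mem_map_of_mem (Submodule.mem_map_of_mem hx))
    rw [← Submodule.Quotient.mk_eq_zero, ← Submodule.mkQ_apply, map_sub, sub_eq_zero]
    exact (LinearMap.congr_fun hs (N.mkQ x)).symm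
  · rintro ⟨G, hG, hM⟩
    have h : M.map N.mkQ ≤ G.map N.mkQ := by
      refine (Submodule.map_mono hM).trans ?_
      rw [Submodule.map_sup, Submodule.mkQ_map_self, bot_sup_eq]
    exact Submodule.finiteDimensional_of_le h

lemma finite_quotInf_of_le {M N : Submodule K E} (h : M ≤ N) :
    FiniteDimensional K (QuotInf M N) :=
  finite_quotInf_iff_exists_le_sup.2 ⟨⊥, inferInstance, h.trans le_sup_left⟩

lemma finite_quotInf_trans {M N L : Submodule K E} (h₁ : FiniteDimensional K (QuotInf M N))
    (h₂ : FiniteDimensional K (QuotInf N L)) : FiniteDimensional K (QuotInf M L) := by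
  rw [finite_quotInf_iff_exists_le_sup] at *
  obtain ⟨G, hG, hM⟩ := h₁
  obtain ⟨G', hG', hN⟩ := h₂
  refine ⟨G' ⊔ G, inferInstance, hM.trans ?_⟩
  rw [← sup_assoc]
  exact sup_le_sup_right hN G

lemma finite_quotInf_mono {M M' N N' : Submodule K E} (hM : M' ≤ M) (hN : N ≤ N')
    (h : FiniteDimensional K (QuotInf M N)) : FiniteDimensional K (QuotInf M' N') :=
  finite_quotInf_trans (finite_quotInf_trans (finite_quotInf_of_le hM) h)
    (finite_quotInf_of_le hN)

lemma finite_quotInf_of_coFG (M : Submodule K E) {V : Submodule K E} (hV : V.CoFG) :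
    FiniteDimensional K (QuotInf M V) := by
  rw [finite_quotInf_iff_map]
  exact Submodule.finiteDimensional_of_le (le_top : _ ≤ (⊤ : Submodule K (E ⧸ V)))

lemma finite_quotInf_inf {M N L : Submodule K E} (h₁ : FiniteDimensional K (QuotInf M N))
    (h₂ : FiniteDimensional K (QuotInf M L)) : FiniteDimensional K (QuotInf M (N ⊓ L)) := by
  have h := Submodule.CoFG.inf (S := (M ⊓ N).submoduleOf M) (T := (M ⊓ L).submoduleOf M) h₁ h₂
  have e : (M ⊓ N).submoduleOf M ⊓ (M ⊓ L).submoduleOf M = (M ⊓ (N ⊓ L)).submoduleOf M := by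
    ext x; simp [Submodule.submoduleOf]
  rwa [e] at h

lemma finrank_quotInf_of_le {M N : Submodule K E} (h : M ≤ N) : finrank K (QuotInf M N) = 0 := by
  have e : M.map N.mkQ = ⊥ := by
    rwa [← le_bot_iff, Submodule.map_le_iff_le_comap, Submodule.comap_bot, Submodule.ker_mkQ]
  rw [finrank_quotInf, e, finrank_bot]

lemma quotInf_inf_self (M N : Submodule K E) :
    finrank K (QuotInf M (M ⊓ N)) = finrank K (QuotInf M N) := by
  unfold QuotInf
  rw [← inf_assoc, inf_idem]

/-- Additivity of relative dimension: `dim M/I = dim M/(M ∩ N) + dim (M ∩ N)/I`. -/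
lemma finrank_quotInf_eq_add {I M N : Submodule K E} (hI : I ≤ N)
    (h : FiniteDimensional K (QuotInf M I)) :
    finrank K (QuotInf M I) = finrank K (QuotInf M N) + finrank K (QuotInf (M ⊓ N) I) := by
  rw [finite_quotInf_iff_map] at h
  simp only [finrank_quotInf]
  let φ : (M.map I.mkQ) →ₗ[K] E ⧸ N := (Submodule.factor hI).domRestrict (M.map I.mkQ)
  have hr : φ.range = M.map N.mkQ := by
    rw [LinearMap.range_domRestrict, ← Submodule.map_comp, Submodule.factor_comp_mk]
  have hk : φ.ker.map (M.map I.mkQ).subtype = (M ⊓ N).map I.mkQ := by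
    ext y
    simp only [Submodule.mem_map, LinearMap.mem_ker, Submodule.subtype_apply, Subtype.exists,
      exists_and_right, exists_eq_right, Submodule.mem_inf]
    constructor
    · rintro ⟨⟨x, hx, rfl⟩, h0⟩
      refine ⟨x, ⟨hx, ?_⟩, rfl⟩
      simpa [φ] using h0
    · rintro ⟨x, ⟨hx, hN⟩, rfl⟩
      exact ⟨⟨x, hx, rfl⟩, by simpa [φ] using hN⟩
  rw [← hr, ← hk, Submodule.finrank_map_subtype_eq]
  exact φ.finrank_range_add_finrank_ker.symm

/-- Two subspaces are commensurable if their intersection has finite codimension in both. -/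
def IsCommensurable (M N : Submodule K E) : Prop :=
  FiniteDimensional K (QuotInf M N) ∧ FiniteDimensional K (QuotInf N M)

/-- The relative index `dim M/(M ∩ N) - dim N/(M ∩ N)` of two commensurable subspaces. -/
noncomputable def relIndex (M N : Submodule K E) : ℤ :=
  (finrank K (QuotInf M N) : ℤ) - finrank K (QuotInf N M)

lemma IsCommensurable.symm {M N : Submodule K E} (h : IsCommensurable M N) :
    IsCommensurable N M := And.symm h

lemma IsCommensurable.trans {M N L : Submodule K E} (h₁ : IsCommensurable M N)
    (h₂ : IsCommensurable N L) : IsCommensurable M L :=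
  ⟨finite_quotInf_trans h₁.1 h₂.1, finite_quotInf_trans h₂.2 h₁.2⟩

lemma relIndex_symm (M N : Submodule K E) : relIndex N M = -relIndex M N := by
  simp [relIndex]

/-- Any common subspace `I` of finite codimension can replace $M\cap N$, because $\dim (M\cap N)/I$
cancels. -/
lemma relIndex_eq_sub {I M N : Submodule K E} (hM : I ≤ M) (hN : I ≤ N)
    (h₁ : FiniteDimensional K (QuotInf M I)) (h₂ : FiniteDimensional K (QuotInf N I)) :
    relIndex M N = (finrank K (QuotInf M I) : ℤ) - finrank K (QuotInf N I) := by
  rw [relIndex, finrank_quotInf_eq_add hN h₁, finrank_quotInf_eq_add hM h₂]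
  have e : finrank K (QuotInf (N ⊓ M) I) = finrank K (QuotInf (M ⊓ N) I) := by rw [inf_comm N M]
  lia

lemma relIndex_add {M N L : Submodule K E} (h₁ : IsCommensurable M N)
    (h₂ : IsCommensurable N L) : relIndex M N + relIndex N L = relIndex M L := by
  have hM : FiniteDimensional K (QuotInf M (M ⊓ N ⊓ L)) :=
    finite_quotInf_inf (finite_quotInf_inf (finite_quotInf_of_le le_rfl) h₁.1) (h₁.trans h₂).1
  have hN : FiniteDimensional K (QuotInf N (M ⊓ N ⊓ L)) :=
    finite_quotInf_inf (finite_quotInf_inf h₁.2 (finite_quotInf_of_le le_rfl)) h₂.1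
  have hL : FiniteDimensional K (QuotInf L (M ⊓ N ⊓ L)) :=
    finite_quotInf_inf (finite_quotInf_inf (h₁.trans h₂).2 h₂.2) (finite_quotInf_of_le le_rfl)
  have iM : M ⊓ N ⊓ L ≤ M := inf_le_left.trans inf_le_left
  have iN : M ⊓ N ⊓ L ≤ N := inf_le_left.trans inf_le_right
  have iL : M ⊓ N ⊓ L ≤ L := inf_le_right
  rw [relIndex_eq_sub iM iN hM hN, relIndex_eq_sub iN iL hN hL, relIndex_eq_sub iM iL hM hL]
  ring

lemma finite_quotInf_range_map (f : E →ₗ[K] F) {V : Submodule K E} (hV : V.CoFG) :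
    FiniteDimensional K (QuotInf f.range (V.map f)) := by
  obtain ⟨G, hG, h⟩ := finite_quotInf_iff_exists_le_sup.1 (finite_quotInf_of_coFG ⊤ hV)
  refine finite_quotInf_iff_exists_le_sup.2 ⟨G.map f, inferInstance, ?_⟩
  rw [LinearMap.range_eq_map, ← Submodule.map_sup]
  exact Submodule.map_mono h

/-- Restricting a linear map to a subspace of finite codimension removes as much from kernel
and range together as from the domain. -/
lemma finrank_quotInf_ker_add_range (f : E →ₗ[K] F) {V : Submodule K E} (hV : V.CoFG) :
    finrank K (QuotInf f.range (V.map f)) + finrank K (QuotInf f.ker V) =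
      finrank K (E ⧸ V) := by
  rw [finrank_quotInf, finrank_quotInf]
  -- Rank-nullity for the induced map $E/V\to F/f(V)$; its kernel comes from $f^{-1}(f(V))=V+N(f)$.
  let φ : (E ⧸ V) →ₗ[K] F ⧸ V.map f := V.mapQ (V.map f) f (Submodule.le_comap_map f V)
  have hr : φ.range = f.range.map (V.map f).mkQ := by
    rw [← LinearMap.range_comp, ← Submodule.mapQ_mkQ V (V.map f) f
      (h := Submodule.le_comap_map f V), LinearMap.range_comp, V.range_mkQ, Submodule.map_top]
  have hk : φ.ker = f.ker.map V.mkQ := by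
    rw [Submodule.ker_mapQ, Submodule.comap_map_eq, Submodule.map_sup, Submodule.mkQ_map_self,
      bot_sup_eq]
  rw [← hr, ← hk]
  exact φ.finrank_range_add_finrank_ker

lemma isCommensurable_ker_of_eqOn {f g : E →ₗ[K] F} {V : Submodule K E} (hV : V.CoFG)
    (h : Set.EqOn f g V) : IsCommensurable f.ker g.ker := by
  have key : ∀ {f g : E →ₗ[K] F}, Set.EqOn f g V → FiniteDimensional K (QuotInf f.ker g.ker) := by
    intro f g h
    refine finite_quotInf_mono le_rfl ?_
      (finite_quotInf_inf (finite_quotInf_of_le le_rfl) (finite_quotInf_of_coFG f.ker hV))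
    rintro x ⟨hx, hxV⟩
    rw [LinearMap.mem_ker, ← h hxV]
    exact hx
  exact ⟨key h, key h.symm⟩

lemma map_eq_map_of_eqOn {f g : E →ₗ[K] F} {V : Submodule K E} (h : Set.EqOn f g V) :
    V.map f = V.map g :=
  SetLike.coe_injective (by simpa using h.image_eq)

lemma isCommensurable_range_of_eqOn {f g : E →ₗ[K] F} {V : Submodule K E} (hV : V.CoFG)
    (h : Set.EqOn f g V) : IsCommensurable f.range g.range := by
  have key : ∀ {f g : E →ₗ[K] F}, Set.EqOn f g V →
      FiniteDimensional K (QuotInf f.range g.range) := by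
    intro f g h
    refine finite_quotInf_mono le_rfl ?_ (finite_quotInf_range_map f hV)
    rw [map_eq_map_of_eqOn h]
    exact LinearMap.map_le_range
  exact ⟨key h, key h.symm⟩

/-- Under a perturbation of finite rank, the kernel grows by as much as the range shrinks. -/
lemma relIndex_ker_eq_relIndex_range {f g : E →ₗ[K] F} {V : Submodule K E} (hV : V.CoFG)
    (h : Set.EqOn f g V) : relIndex f.ker g.ker = relIndex g.range f.range := by
  have hI : f.ker ⊓ V = g.ker ⊓ V := by
    ext x
    simp only [Submodule.mem_inf, LinearMap.mem_ker]
    exact and_congr_left fun hx ↦ by rw [h hx]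
  have fin (f : E →ₗ[K] F) : FiniteDimensional K (QuotInf f.ker (f.ker ⊓ V)) :=
    finite_quotInf_inf (finite_quotInf_of_le le_rfl) (finite_quotInf_of_coFG f.ker hV)
  have hJ := map_eq_map_of_eqOn h
  have h₁ := relIndex_eq_sub (I := f.ker ⊓ V) (M := f.ker) (N := g.ker) inf_le_left
    (hI ▸ inf_le_left) (fin f) (hI ▸ fin g)
  have h₂ := relIndex_eq_sub (I := V.map f) (M := g.range) (N := f.range)
    (hJ ▸ LinearMap.map_le_range) LinearMap.map_le_range
    (hJ ▸ finite_quotInf_range_map g hV) (finite_quotInf_range_map f hV)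
  have e : finrank K (QuotInf g.ker (f.ker ⊓ V)) = finrank K (QuotInf g.ker V) := by
    rw [hI, quotInf_inf_self]
  rw [quotInf_inf_self, e] at h₁
  rw [h₁, h₂, hJ]
  -- Measured against the shared $N(f)\cap V$ and $f(V)$, kernel and range contribute the same total
  -- $\dim E/V$ for `f` and `g`.
  have ef := finrank_quotInf_ker_add_range f hV
  have eg := finrank_quotInf_ker_add_range g hV
  rw [hJ] at ef
  lia

end RelativeDimension

/-! ### Fredholm operators, closed ranges and adjoints -/

section FredholmOperators

open ContinuousLinearMap LinearMap.FiniteRangeSetoid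

variable {𝕜 E F : Type*} [RCLike 𝕜]
  [NormedAddCommGroup E] [InnerProductSpace 𝕜 E]
  [NormedAddCommGroup F] [InnerProductSpace 𝕜 F]

lemma fredholmIndex_eq_relIndex (A : E →L[𝕜] F) :
    fredholmIndex A = relIndex A.ker ⊥ - relIndex ⊤ A.range := by
  have h₁ : finrank 𝕜 (QuotInf A.ker ⊥) = finrank 𝕜 A.ker := by
    rw [finrank_quotInf]
    exact LinearEquiv.finrank_eq
      (Submodule.equivMapOfInjective _ (LinearMap.ker_eq_bot.1 (Submodule.ker_mkQ _)) _).symm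
  have h₂ : finrank 𝕜 (QuotInf ⊤ A.range) = finrank 𝕜 (F ⧸ A.range) := by
    rw [finrank_quotInf, Submodule.map_top, Submodule.range_mkQ, finrank_top]
  rw [relIndex, relIndex, h₁, h₂, finrank_quotInf_of_le bot_le, finrank_quotInf_of_le le_top,
    fredholmIndex]
  simp

/-- The index of a Fredholm operator is invariant under perturbations of finite rank. -/
lemma ContinuousLinearMap.IsFredholm.fredholmIndex_congr {A B : E →L[𝕜] F} (hA : A.IsFredholm)
    {V : Submodule 𝕜 E} (hV : V.CoFG) (h : Set.EqOn A B V) :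
    fredholmIndex A = fredholmIndex B := by
  have hk : IsCommensurable A.ker B.ker := isCommensurable_ker_of_eqOn hV h
  have hr : IsCommensurable A.range B.range := isCommensurable_range_of_eqOn hV h
  have e : relIndex A.ker B.ker = relIndex B.range A.range := relIndex_ker_eq_relIndex_range hV h
  have hk' : IsCommensurable A.ker ⊥ := by
    have := hA.finite_ker
    exact ⟨inferInstance, finite_quotInf_of_le bot_le⟩
  have hr' : IsCommensurable ⊤ A.range :=
    ⟨finite_quotInf_of_coFG _ hA.finite_coker, finite_quotInf_of_le le_top⟩
  have e₁ := relIndex_add hk.symm hk'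
  have e₂ := relIndex_add hr' hr
  rw [relIndex_symm] at e₁
  rw [fredholmIndex_eq_relIndex, fredholmIndex_eq_relIndex]
  have := relIndex_symm A.range B.range
  lia

lemma ContinuousLinearMap.IsFredholm.congr_of_eqOn {A B : E →L[𝕜] F} (hA : A.IsFredholm)
    {V : Submodule 𝕜 E} (hV : V.CoFG) (h : Set.EqOn A B V) : B.IsFredholm := by
  obtain ⟨v, hv⟩ := hA.exists_isQuasiInverse
  exact .of_isQuasiInverse (hv.congr (Setoid.refl _)
    (equiv_of_eqOn_coFG hV h.symm))

lemma ker_domRestrict_orthogonal_ker (A : E →L[𝕜] F) : (A.domRestrict A.kerᗮ).ker = ⊥ := by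
  rw [LinearMap.ker_eq_bot']
  rintro ⟨x, hx⟩ h0
  have hx' : x ∈ A.ker := h0
  exact Subtype.ext (inner_self_eq_zero.1 (hx x hx'))

variable [CompleteSpace E]

lemma isClosed_range_of_ker_eq_bot_of_coFG [CompleteSpace F] (A : E →L[𝕜] F) (hk : A.ker = ⊥)
    (hA : A.range.CoFG) : IsClosed (A.range : Set F) := by
  obtain ⟨G, hG⟩ := A.range.exists_isCompl
  have : FiniteDimensional 𝕜 G := .of_fg (hA.fg_of_isCompl hG)
  exact A.closed_complemented_range_of_isCompl_of_ker_eq_bot G hG G.closed_of_finiteDimensional hk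

lemma range_domRestrict_orthogonal_ker (A : E →L[𝕜] F) :
    (A.domRestrict A.kerᗮ).range = A.range := by
  have : CompleteSpace A.ker := A.isClosed_ker.completeSpace_coe
  refine le_antisymm ?_ ?_
  · rintro _ ⟨x, rfl⟩
    exact ⟨x, rfl⟩
  · rintro _ ⟨x, rfl⟩
    refine ⟨⟨x - A.ker.starProjection x, A.ker.sub_starProjection_mem_orthogonal x⟩, ?_⟩
    have : A (A.ker.starProjection x) = 0 := A.ker.starProjection_apply_mem x
    simp [this]

/-- A range which has finite codimension in a closed subspace is closed. -/
lemma isClosed_range_of_finite_quotInf [CompleteSpace F] (A : E →L[𝕜] F) {M : Submodule 𝕜 F}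
    (hM : IsClosed (M : Set F)) (hAM : A.range ≤ M)
    (h : FiniteDimensional 𝕜 (QuotInf M A.range)) : IsClosed (A.range : Set F) := by
  have : CompleteSpace M := hM.completeSpace_coe
  -- Restricting to $N(A)^\perp$ gives injectivity without changing the range, which is then
  -- cofinite in the Hilbert space `M`.
  let f : A.kerᗮ →L[𝕜] M :=
    (A.domRestrict A.kerᗮ).codRestrict M fun x ↦ hAM ⟨x, rfl⟩
  have hfr : f.range.map M.subtype = A.range := by
    rw [← range_domRestrict_orthogonal_ker A, ← LinearMap.range_comp]
    rfl
  have hfk : f.ker = ⊥ := by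
    rw [← ker_domRestrict_orthogonal_ker A]
    ext x
    simp [f]
  have hf : f.range.CoFG := by
    have e : f.range = (M ⊓ A.range).submoduleOf M := by
      rw [← hfr]
      ext x
      simp [Submodule.submoduleOf]
    rw [e]
    exact h
  have hc := isClosed_range_of_ker_eq_bot_of_coFG f hfk hf
  rw [← hfr, Submodule.map_coe]
  exact hM.isClosedEmbedding_subtypeVal.isClosedMap _ hc

/-- An operator between Hilbert spaces with finite dimensional kernel and cokernel is Fredholm. -/
lemma isFredholm_of_finite [CompleteSpace F] {A : E →L[𝕜] F} (hk : FiniteDimensional 𝕜 A.ker)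
    (hr : A.range.CoFG) : A.IsFredholm := by
  have hc : IsClosed (A.range : Set F) :=
    isClosed_range_of_finite_quotInf A isClosed_univ (M := ⊤) le_top
      (finite_quotInf_of_coFG _ hr)
  have : CompleteSpace A.range := hc.completeSpace_coe
  refine ⟨?_, hc, hk, hr, .of_finiteDimensional _⟩
  refine A.toLinearMap.isStrictMap_iff_isOpenQuotientMap_rangeRestrict.2 ?_
  have hs : Function.Surjective A.rangeRestrict := LinearMap.surjective_rangeRestrict _
  exact ⟨hs, A.rangeRestrict.continuous, A.rangeRestrict.isOpenMap hs⟩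

/-- A continuous operator with closed range has a continuous generalized inverse. -/
lemma exists_comp_comp_eq_self [CompleteSpace F] (A : E →L[𝕜] F)
    (hA : IsClosed (A.range : Set F)) : ∃ B : F →L[𝕜] E, A ∘L B ∘L A = A := by
  let g := A.domRestrict A.kerᗮ
  have hg : g.range = A.range := range_domRestrict_orthogonal_ker A
  have hc : IsClosed (g.range : Set F) := by rwa [hg]
  have : CompleteSpace g.range := hc.completeSpace_coe
  let e := g.equivRange (LinearMap.ker_eq_bot.1 (ker_domRestrict_orthogonal_ker A)) hc
  -- Project onto $R(A)$, then invert the bijection $N(A)^\perp\to R(A)$.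
  refine ⟨A.kerᗮ.subtypeL ∘L (e.symm : g.range →L[𝕜] A.kerᗮ) ∘L g.range.orthogonalProjectionOnto, ?_⟩
  ext x
  have hx : A x ∈ g.range := hg ▸ ⟨x, rfl⟩
  have h₁ : g.range.orthogonalProjectionOnto (A x) = ⟨A x, hx⟩ :=
    Submodule.orthogonalProjectionOnto_mem_subspace_eq_self (K := g.range) ⟨A x, hx⟩
  have h₂ : ((e (e.symm ⟨A x, hx⟩) : g.range) : F) = A x := by simp
  simp only [comp_apply, h₁]
  exact h₂

variable [CompleteSpace F]

/-- With $ABA=A$, each $x-BAx$ lies in $N(A)$, so $w\perp N(A)$ forces $w=A^*B^*w$. -/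
lemma orthogonal_ker_le_range_adjoint (A : E →L[𝕜] F) (hA : IsClosed (A.range : Set F)) :
    A.kerᗮ ≤ (adjoint A).range := by
  obtain ⟨B, hB⟩ := exists_comp_comp_eq_self A hA
  intro w hw
  refine ⟨adjoint B w, ext_inner_right 𝕜 fun x ↦ ?_⟩
  have hx : x - B (A x) ∈ A.ker := by
    have := congr($hB x)
    simpa [sub_eq_zero] using this.symm
  have h := Submodule.inner_left_of_mem_orthogonal hx hw
  rw [inner_sub_right, sub_eq_zero] at h
  simp [adjoint_inner_left, h]

/-- $R(A^*)$ lies in $N(A)^\perp$, which meets the cofinite subspace $N(A)$ trivially. -/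
lemma coFG_ker_adjoint (A : E →L[𝕜] F) (hA : A.ker.CoFG) :
    (adjoint A).ker.CoFG := by
  rw [← Submodule.range_fg_iff_ker_cofg]
  have h : (adjoint A).range ≤ A.kerᗮ := by
    rintro _ ⟨y, rfl⟩ x hx
    have : A x = 0 := hx
    simp [adjoint_inner_right, this]
  exact hA.fg_of_disjoint (A.ker.orthogonal_disjoint.symm.mono_left h)

lemma finrank_quotient_range (A : E →L[𝕜] F) (hA : IsClosed (A.range : Set F)) :
    finrank 𝕜 (F ⧸ A.range) = finrank 𝕜 (adjoint A).ker := by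
  have : CompleteSpace A.range := hA.completeSpace_coe
  rw [← orthogonal_range]
  exact (Submodule.quotientEquivOfIsCompl _ _ A.range.isCompl_orthogonal).finrank_eq

/-- The adjoint of a Fredholm operator is Fredholm. -/
lemma ContinuousLinearMap.IsFredholm.adjoint {A : E →L[𝕜] F} (hA : A.IsFredholm) :
    (adjoint A).IsFredholm := by
  refine isFredholm_of_finite ?_ ?_
  · have : CompleteSpace A.range := hA.isClosed_range.completeSpace_coe
    rw [← orthogonal_range]
    exact .of_fg (hA.finite_coker.fg_of_isCompl A.range.isCompl_orthogonal)
  · have := hA.finite_ker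
    refine Submodule.CoFG.of_le (orthogonal_ker_le_range_adjoint A hA.isClosed_range) ?_
    exact (Submodule.fg_iff_finiteDimensional _).2 this |>.cofg_of_isCompl A.ker.isCompl_orthogonal

lemma ContinuousLinearMap.IsFredholm.fredholmIndex_adjoint {A : E →L[𝕜] F} (hA : A.IsFredholm) :
    fredholmIndex (ContinuousLinearMap.adjoint A) = -fredholmIndex A := by
  rw [fredholmIndex, fredholmIndex, finrank_quotient_range A hA.isClosed_range,
    finrank_quotient_range _ hA.adjoint.isClosed_range, adjoint_adjoint]
  ring

end FredholmOperators

/-! ### Fredholm pairs and their perturbation -/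

section FredholmPairs

open ContinuousLinearMap LinearMap.FiniteRangeSetoid

variable {𝕜 H₁ H₂ : Type*} [RCLike 𝕜]
  [NormedAddCommGroup H₁] [InnerProductSpace 𝕜 H₁]
  [NormedAddCommGroup H₂] [InnerProductSpace 𝕜 H₂]

lemma isFredholmPair_iff {S : H₁ →L[𝕜] H₂} {T : H₂ →L[𝕜] H₁} :
    IsFredholmPair S T ↔ IsCommensurable S.ker T.range ∧ IsCommensurable T.ker S.range :=
  ⟨fun h ↦ ⟨⟨h.1, h.2⟩, h.3, h.4⟩, fun h ↦ ⟨h.1.1, h.1.2, h.2.1, h.2.2⟩⟩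

lemma pairIndex_eq_relIndex (S : H₁ →L[𝕜] H₂) (T : H₂ →L[𝕜] H₁) :
    pairIndex S T = relIndex S.ker T.range - relIndex T.ker S.range := by
  rw [pairIndex, relIndex, relIndex]
  ring

lemma IsFredholmPair.symm {S : H₁ →L[𝕜] H₂} {T : H₂ →L[𝕜] H₁} (h : IsFredholmPair S T) :
    IsFredholmPair T S :=
  ⟨h.3, h.4, h.1, h.2⟩

lemma pairIndex_symm (S : H₁ →L[𝕜] H₂) (T : H₂ →L[𝕜] H₁) : pairIndex T S = -pairIndex S T := by
  rw [pairIndex_eq_relIndex, pairIndex_eq_relIndex]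
  ring

/-- The corrections $[N(S'):N(S)]$ and $[R(S):R(S')]$ are equal and enter the index with opposite
signs. -/
lemma IsFredholmPair.congr_left {S S' : H₁ →L[𝕜] H₂} {T : H₂ →L[𝕜] H₁} (h : IsFredholmPair S T)
    {V : Submodule 𝕜 H₁} (hV : V.CoFG) (hS : Set.EqOn S S' V) :
    IsFredholmPair S' T ∧ pairIndex S' T = pairIndex S T := by
  rw [isFredholmPair_iff] at h ⊢
  have hk : IsCommensurable S.ker S'.ker := isCommensurable_ker_of_eqOn hV hS
  have hr : IsCommensurable S.range S'.range := isCommensurable_range_of_eqOn hV hS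
  have e : relIndex S.ker S'.ker = relIndex S'.range S.range :=
    relIndex_ker_eq_relIndex_range hV hS
  refine ⟨⟨hk.symm.trans h.1, h.2.trans hr⟩, ?_⟩
  have e₁ := relIndex_add hk.symm h.1
  have e₂ := relIndex_add h.2 hr
  have e₃ := relIndex_symm S.ker S'.ker
  have e₄ := relIndex_symm S.range S'.range
  rw [pairIndex_eq_relIndex, pairIndex_eq_relIndex]
  lia

/-- Fredholm pairs and their index are invariant under perturbations of finite rank. -/
lemma IsFredholmPair.congr {S S' : H₁ →L[𝕜] H₂} {T T' : H₂ →L[𝕜] H₁} (h : IsFredholmPair S T)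
    {V : Submodule 𝕜 H₁} (hV : V.CoFG) (hS : Set.EqOn S S' V)
    {W : Submodule 𝕜 H₂} (hW : W.CoFG) (hT : Set.EqOn T T' W) :
    IsFredholmPair S' T' ∧ pairIndex S' T' = pairIndex S T := by
  obtain ⟨h₁, e₁⟩ := h.congr_left hV hS
  obtain ⟨h₂, e₂⟩ := h₁.symm.congr_left hW hT
  refine ⟨h₂.symm, ?_⟩
  rw [pairIndex_symm, e₂, pairIndex_symm, neg_neg, e₁]

lemma range_le_ker_of_comp_eq_zero {S : H₁ →L[𝕜] H₂} {T : H₂ →L[𝕜] H₁}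
    (hST : S ∘L T = 0) : T.range ≤ S.ker := by
  rintro _ ⟨v, rfl⟩
  exact congr($hST v)

variable [CompleteSpace H₁] [CompleteSpace H₂]

lemma ker_add_adjoint {S : H₁ →L[𝕜] H₂} {T : H₂ →L[𝕜] H₁} (hTS : T ∘L S = 0) :
    (S + adjoint T).ker = S.ker ⊓ T.rangeᗮ := by
  rw [orthogonal_range]
  ext x
  simp only [LinearMap.mem_ker, Submodule.mem_inf, coe_coe, add_apply]
  refine ⟨fun h ↦ ?_, fun h ↦ by rw [h.1, h.2, add_zero]⟩
  have h0 : inner 𝕜 (S x) (adjoint T x) = 0 := by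
    rw [adjoint_inner_right, ← comp_apply, hTS, zero_apply, inner_zero_left]
  have hS : S x = 0 := by
    rw [← inner_self_eq_zero (𝕜 := 𝕜)]
    nth_rw 2 [eq_neg_of_add_eq_zero_left h]
    rw [inner_neg_right, h0, neg_zero]
  exact ⟨hS, by simpa [hS] using h⟩

/-- Removing from `u` its component in $N(S)$ keeps $Su$; the rest is orthogonal to $R(T)\subseteq
N(S)$, so $T^*$ kills it. -/
lemma range_le_range_add_adjoint {S : H₁ →L[𝕜] H₂} {T : H₂ →L[𝕜] H₁} (hST : S ∘L T = 0) :
    S.range ≤ (S + adjoint T).range := by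
  have : CompleteSpace S.ker := S.isClosed_ker.completeSpace_coe
  rintro _ ⟨u, rfl⟩
  have h₁ : S (S.ker.starProjection u) = 0 := S.ker.starProjection_apply_mem u
  have h₂ : u - S.ker.starProjection u ∈ (adjoint T).ker := by
    rw [← orthogonal_range]
    exact Submodule.orthogonal_le (range_le_ker_of_comp_eq_zero hST)
      (S.ker.sub_starProjection_mem_orthogonal u)
  refine ⟨u - S.ker.starProjection u, ?_⟩
  have h₃ : adjoint T (u - S.ker.starProjection u) = 0 := h₂
  rw [coe_coe, add_apply, h₃, map_sub, h₁]
  simp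

lemma range_adjoint_le_range_add_adjoint {S : H₁ →L[𝕜] H₂} {T : H₂ →L[𝕜] H₁}
    (hST : S ∘L T = 0) : (adjoint T).range ≤ (S + adjoint T).range := by
  have h : adjoint T ∘L adjoint S = 0 := by rw [← adjoint_comp, hST, map_zero]
  have := range_le_range_add_adjoint h
  rwa [adjoint_adjoint, add_comm] at this

lemma adjoint_add_adjoint (S : H₁ →L[𝕜] H₂) (T : H₂ →L[𝕜] H₁) :
    adjoint (S + adjoint T) = T + adjoint S := by
  rw [map_add, adjoint_adjoint, add_comm]

/-! ### The case of vanishing compositions -/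

section Exact

variable {S : H₁ →L[𝕜] H₂} {T : H₂ →L[𝕜] H₁}

lemma finite_ker_and_finrank_ker_add_adjoint (hTS : T ∘L S = 0) (hST : S ∘L T = 0)
    (h : FiniteDimensional 𝕜 (QuotInf S.ker T.range)) :
    FiniteDimensional 𝕜 (S + adjoint T).ker ∧
      finrank 𝕜 (S + adjoint T).ker = finrank 𝕜 (QuotInf S.ker T.range) := by
  have hTS' := range_le_ker_of_comp_eq_zero hST
  have hc : IsClosed (T.range : Set H₁) :=
    isClosed_range_of_finite_quotInf T S.isClosed_ker hTS' h
  have : CompleteSpace T.range := hc.completeSpace_coe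
  rw [ker_add_adjoint hTS]
  have hsup : T.range ⊔ S.ker ⊓ T.rangeᗮ = S.ker := by
    rw [inf_comm, ← sup_inf_assoc_of_le _ hTS', T.range.isCompl_orthogonal.sup_eq_top, top_inf_eq]
  have hdisj : Disjoint T.range (S.ker ⊓ T.rangeᗮ) :=
    T.range.orthogonal_disjoint.mono_right inf_le_right
  let φ := T.range.mkQ.domRestrict (S.ker ⊓ T.rangeᗮ)
  have hφ : Function.Injective φ := by
    rw [← LinearMap.ker_eq_bot, LinearMap.ker_domRestrict, Submodule.ker_mkQ,
      ← Submodule.disjoint_iff_comap_eq_bot]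
    exact hdisj.symm
  have hr : φ.range = S.ker.map T.range.mkQ := by
    rw [LinearMap.range_domRestrict]
    conv_rhs => rw [← hsup]
    rw [Submodule.map_sup, Submodule.mkQ_map_self, bot_sup_eq]
  let e := (LinearEquiv.ofInjective φ hφ).trans (LinearEquiv.ofEq _ _ hr)
  rw [finrank_quotInf, e.finrank_eq]
  rw [finite_quotInf_iff_map] at h
  exact ⟨.of_injective e.toLinearMap e.injective, rfl⟩

/-- The range contains $R(S)$, cofinite in $N(T)$, and $R(T^*)\supseteq N(T)^\perp$. -/
lemma coFG_range_add_adjoint (hST : S ∘L T = 0)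
    (h : IsFredholmPair S T) : (S + adjoint T).range.CoFG := by
  have hc : IsClosed (T.range : Set H₁) :=
    isClosed_range_of_finite_quotInf T S.isClosed_ker (range_le_ker_of_comp_eq_zero hST) h.finite_a
  have : CompleteSpace T.ker := T.isClosed_ker.completeSpace_coe
  obtain ⟨G, hG, hle⟩ := finite_quotInf_iff_exists_le_sup.1 h.finite_c
  refine Submodule.FG.cofg_of_codisjoint (S := G) (codisjoint_iff_le_sup.2 ?_)
    ((Submodule.fg_iff_finiteDimensional _).2 hG)
  rw [← T.ker.isCompl_orthogonal.sup_eq_top, sup_comm G]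
  refine sup_le (hle.trans (sup_le_sup_right (range_le_range_add_adjoint hST) G)) ?_
  exact (orthogonal_ker_le_range_adjoint T hc).trans
    ((range_adjoint_le_range_add_adjoint hST).trans le_sup_left)

lemma IsFredholmPair.isFredholm_of_comp_eq_zero (hTS : T ∘L S = 0) (hST : S ∘L T = 0)
    (h : IsFredholmPair S T) :
    (S + adjoint T).IsFredholm ∧ pairIndex S T = fredholmIndex (S + adjoint T) := by
  obtain ⟨hk, ek⟩ := finite_ker_and_finrank_ker_add_adjoint hTS hST h.finite_a
  -- The roles of `S` and `T` are swapped: the cokernel is measured by $N(T+S^*)$.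
  obtain ⟨-, ek'⟩ := finite_ker_and_finrank_ker_add_adjoint hST hTS h.finite_c
  have hA := isFredholm_of_finite hk (coFG_range_add_adjoint hST h)
  refine ⟨hA, ?_⟩
  rw [fredholmIndex, finrank_quotient_range _ hA.isClosed_range, adjoint_add_adjoint, ek, ek',
    pairIndex, finrank_quotInf_of_le (range_le_ker_of_comp_eq_zero hST),
    finrank_quotInf_of_le (range_le_ker_of_comp_eq_zero hTS)]
  simp

/-- Projection onto $N(T)$ fixes $Su$ and kills $T^*u$, so it carries a finite complement of
$R(S+T^*)$ to one that completes $R(S)$ to $N(T)$. -/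
lemma finite_quotInf_ker_range_of_coFG (hTS : T ∘L S = 0)
    (h : (S + adjoint T).range.CoFG) : FiniteDimensional 𝕜 (QuotInf T.ker S.range) := by
  have : CompleteSpace T.ker := T.isClosed_ker.completeSpace_coe
  obtain ⟨G, hG, hle⟩ := finite_quotInf_iff_exists_le_sup.1 (finite_quotInf_of_coFG ⊤ h)
  let P := T.ker.starProjection
  refine finite_quotInf_iff_exists_le_sup.2 ⟨G.map P.toLinearMap, inferInstance, fun x hx ↦ ?_⟩
  obtain ⟨_, ⟨u, rfl⟩, g, hg, hug⟩ := Submodule.mem_sup.1 (hle (Submodule.mem_top (x := x)))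
  have h₁ : P x = x := T.ker.starProjection_eq_self_iff.2 hx
  have h₂ : P (S u) = S u :=
    T.ker.starProjection_eq_self_iff.2 (range_le_ker_of_comp_eq_zero hTS ⟨u, rfl⟩)
  have h₃ : P (adjoint T u) = 0 := by
    refine (T.ker.starProjection_apply_eq_zero_iff).2 fun y hy ↦ ?_
    have : T y = 0 := hy
    rw [adjoint_inner_right, this, inner_zero_left]
  rw [← h₁, ← hug, map_add, coe_coe, add_apply, map_add, h₂, h₃, add_zero]
  exact Submodule.add_mem_sup ⟨u, rfl⟩ (Submodule.mem_map_of_mem hg)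

lemma isFredholmPair_of_isFredholm_of_comp_eq_zero (hTS : T ∘L S = 0) (hST : S ∘L T = 0)
    (h : (S + adjoint T).IsFredholm) : IsFredholmPair S T where
  finite_a := finite_quotInf_ker_range_of_coFG hST
    (adjoint_add_adjoint S T ▸ h.adjoint.finite_coker)
  finite_b := finite_quotInf_of_le (range_le_ker_of_comp_eq_zero hST)
  finite_c := finite_quotInf_ker_range_of_coFG hTS h.finite_coker
  finite_d := finite_quotInf_of_le (range_le_ker_of_comp_eq_zero hTS)

end Exact

/-! ### Reduction to vanishing compositions -/

/-- If `TS` and `ST` have finite rank, then `S` and `T` are perturbations of finite rank of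
operators whose compositions vanish. -/
lemma exists_comp_eq_zero_of_finite_range (S : H₁ →L[𝕜] H₂) (T : H₂ →L[𝕜] H₁)
    (hTS : FiniteDimensional 𝕜 (T ∘L S).range) (hST : FiniteDimensional 𝕜 (S ∘L T).range) :
    ∃ (S' : H₁ →L[𝕜] H₂) (T' : H₂ →L[𝕜] H₁) (V : Submodule 𝕜 H₁) (W : Submodule 𝕜 H₂),
      T' ∘L S' = 0 ∧ S' ∘L T' = 0 ∧ V.CoFG ∧ W.CoFG ∧ Set.EqOn S S' V ∧ Set.EqOn T T' W := by
  have : CompleteSpace (T ∘L S).ker := (T ∘L S).isClosed_ker.completeSpace_coe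
  have hV : (T ∘L S).ker.CoFG :=
    Submodule.range_fg_iff_ker_cofg.1 ((Submodule.fg_iff_finiteDimensional _).2 hTS)
  let S' : H₁ →L[𝕜] H₂ := S ∘L (T ∘L S).ker.starProjection
  have hS : Set.EqOn S S' (T ∘L S).ker := fun x hx ↦ by
    simp only [S', comp_apply, Submodule.starProjection_eq_self_iff.2 hx]
  have hTS' (x : H₁) : T (S' x) = 0 := (T ∘L S).ker.starProjection_apply_mem x
  have : CompleteSpace (S' ∘L T).ker := (S' ∘L T).isClosed_ker.completeSpace_coe
  have hW : (S' ∘L T).ker.CoFG := by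
    have h₁ : S'.toLinearMap ∘ₗ T.toLinearMap ≈ S.toLinearMap ∘ₗ T.toLinearMap :=
      equiv_comp_right (equiv_of_eqOn_coFG hV hS.symm)
    have h₂ : S.toLinearMap ∘ₗ T.toLinearMap ≈ 0 :=
      equiv_zero_iff_hasFiniteRange.2 ((Submodule.fg_iff_finiteDimensional _).2 hST)
    exact Submodule.range_fg_iff_ker_cofg.1
      (equiv_zero_iff_hasFiniteRange.1 (Setoid.trans h₁ h₂)).fg_range
  let T' : H₂ →L[𝕜] H₁ := T ∘L (S' ∘L T).ker.starProjection
  refine ⟨S', T', (T ∘L S).ker, (S' ∘L T).ker, ?_, ?_, hV, hW, hS, fun x hx ↦ ?_⟩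
  · ext x
    -- Since $TS'=0$, the projection defining `T'` fixes $R(S')$, so $T'S'=TS'=0$.
    have hx : S' x ∈ (S' ∘L T).ker := by
      rw [LinearMap.mem_ker, coe_coe, comp_apply, hTS', map_zero]
    simp only [T', comp_apply, Submodule.starProjection_eq_self_iff.2 hx, hTS', zero_apply]
  · ext x
    exact (S' ∘L T).ker.starProjection_apply_mem x
  · simp only [T', comp_apply, Submodule.starProjection_eq_self_iff.2 hx]

/-- $T-T'$ has finite rank, hence so does its adjoint, and $T^*$ and $T'^*$ agree on the kernel of
that adjoint. -/
lemma exists_coFG_eqOn_add_adjoint {S S' : H₁ →L[𝕜] H₂} {T T' : H₂ →L[𝕜] H₁}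
    {V : Submodule 𝕜 H₁} (hV : V.CoFG) (hS : Set.EqOn S S' V)
    {W : Submodule 𝕜 H₂} (hW : W.CoFG) (hT : Set.EqOn T T' W) :
    ∃ U : Submodule 𝕜 H₁, U.CoFG ∧ Set.EqOn ⇑(S + adjoint T) ⇑(S' + adjoint T') U := by
  have hk : (T - T').ker.CoFG := hW.of_le fun x hx ↦ by
    simpa [sub_eq_zero] using hT hx
  refine ⟨V ⊓ (adjoint (T - T')).ker, hV.inf (coFG_ker_adjoint _ hk), fun x hx ↦ ?_⟩
  have h : adjoint T x = adjoint T' x := by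
    simpa [sub_eq_zero] using hx.2
  rw [add_apply, add_apply, h, hS hx.1]

end FredholmPairs

theorem theorem4p2 {𝕜 H₁ H₂ : Type*} [RCLike 𝕜]
    [NormedAddCommGroup H₁] [InnerProductSpace 𝕜 H₁] [CompleteSpace H₁]
    [NormedAddCommGroup H₂] [InnerProductSpace 𝕜 H₂] [CompleteSpace H₂]
    (S : H₁ →L[𝕜] H₂) (T : H₂ →L[𝕜] H₁)
    (hTS : FiniteDimensional 𝕜 (T ∘L S).range)
    (hST : FiniteDimensional 𝕜 (S ∘L T).range) :
    (IsFredholmPair S T ↔ (S + ContinuousLinearMap.adjoint T).IsFredholm) ∧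
    ((S + ContinuousLinearMap.adjoint T).IsFredholm ↔
      (T + ContinuousLinearMap.adjoint S).IsFredholm) ∧
    (IsFredholmPair S T →
      pairIndex S T = fredholmIndex (S + ContinuousLinearMap.adjoint T) ∧
      fredholmIndex (S + ContinuousLinearMap.adjoint T) =
        -fredholmIndex (T + ContinuousLinearMap.adjoint S)) := by
  obtain ⟨S', T', V, W, hTS', hST', hV, hW, hS, hT⟩ :=
    exists_comp_eq_zero_of_finite_range S T hTS hST
  obtain ⟨U, hU, hA⟩ := exists_coFG_eqOn_add_adjoint hV hS hW hT
  have forward (h : IsFredholmPair S T) : (S + ContinuousLinearMap.adjoint T).IsFredholm ∧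
      pairIndex S T = fredholmIndex (S + ContinuousLinearMap.adjoint T) := by
    obtain ⟨h', e⟩ := h.congr hV hS hW hT
    obtain ⟨hF, e'⟩ := h'.isFredholm_of_comp_eq_zero hTS' hST'
    exact ⟨hF.congr_of_eqOn hU hA.symm, by rw [← e, e', hF.fredholmIndex_congr hU hA.symm]⟩
  refine ⟨⟨fun h ↦ (forward h).1, fun h ↦ ?_⟩, ⟨fun h ↦ ?_, fun h ↦ ?_⟩, fun h ↦ ⟨(forward h).2, ?_⟩⟩
  · exact ((isFredholmPair_of_isFredholm_of_comp_eq_zero hTS' hST'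
      (h.congr_of_eqOn hU hA)).congr hV hS.symm hW hT.symm).1
  · exact adjoint_add_adjoint S T ▸ h.adjoint
  · exact adjoint_add_adjoint T S ▸ h.adjoint
  · rw [← adjoint_add_adjoint S T, (forward h).1.fredholmIndex_adjoint, neg_neg]
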